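/- Let $\mathbb{T}=\mathbb{R}/2\pi\mathbb{Z}$ with arc length measure, let $\log^+ t=\max\{\log t,0\}$ for $t>0$ and $\log^+0=0$, and for a measurable $f:\mathbb{T}\to\mathbb{C}$ let $$M(f)(x)=\sup_{r>0}\frac{1}{|B(x,r)|}\int_{B(x,r)}|f(y)|\,dy\in[0,\infty],\qquad x\in\mathbb{T},$$ be its Hardy–Littlewood maximal function, where $B(x,r)$ is the open arc of all points at distance less than $r$ from $x$. For $\Phi:[0,\infty)\to[0,\infty)$ with $\Phi(t)\to\infty$ as $t\to\infty$, put $\Phi(\infty)=\infty$ and let $L_\Phi(\mathbb{T})$ be the class of all integrable functions $g$ on $\mathbb{T}$ with $\int_{\mathbb{T}}\Phi(|g|)\,dx<\infty$. Then for every measurable $f:\mathbb{T}\to\mathbb{C}$ the following hold. 1. For $\Psi(t)=t\,\log^+t\,\log^+\log^+t$, one has $M(f)\in L_\Psi(\mathbb{T})$ if and only if $f\in L\log^2L\log\log L(\mathbb{T})$, that is, $f$ is integrable and $$\int_{\mathbb{T}}|f|\,(\log^+|f|)^2\,\log^+\log^+|f|\,dx<\infty.$$ 2. One has $$\int_{\mathbb{T}}\frac{M(f)}{\log(e+M(f))}\,\log^+\log^+\log^+\log^+M(f)\,dx<\infty$$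 (the integrand being read as $\infty$ where $M(f)=\infty$) if and only if $f\in L\log\log L\log\log\log\log L(\mathbb{T})$, that is, $f$ is integrable and $$\int_{\mathbb{T}}|f|\,\log^+\log^+|f|\,\log^+\log^+\log^+\log^+|f|\,dx<\infty.$$ -/

import Mathlib

open MeasureTheory
open scoped ENNReal Real

instance factTwoPiPos : Fact ((0 : ℝ) < 2 * π) := ⟨Real.two_pi_pos⟩

/-- The torus `𝕋 = ℝ / 2πℤ`, with its quotient metric and with arc length (of total mass `2π`)
as its measure `volume`. -/
abbrev Torus : Type := AddCircle (2 * π)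

/-- The centred Hardy-Littlewood maximal function on the torus,
`M(f)(x) = sup_{r > 0} |B(x,r)|⁻¹ ∫_{B(x,r)} |f|`, with values in `[0, ∞]`. -/
noncomputable def maximalFunction (f : Torus → ℂ) (x : Torus) : ℝ≥0∞ :=
  ⨆ (r : ℝ) (_ : 0 < r), ⨍⁻ y in Metric.ball x r, ‖f y‖ₑ ∂volume

/-- The value `Φ(t)` at `t ∈ [0, ∞]` of a function `Φ ≥ 0` on `[0, ∞)` that tends to `∞` at `∞`,
with `Φ(∞) = ∞`. -/
noncomputable def orliczEval (Φ : ℝ → ℝ) (t : ℝ≥0∞) : ℝ≥0∞ :=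
  if t = ∞ then ∞ else ENNReal.ofReal (Φ t.toReal)

/-- For a function on the torus of modulus `g`: membership in the class `L_Φ(𝕋)` of the integrable
functions with `∫_𝕋 Φ(g) < ∞`. -/
structure MemOrliczClass (Φ : ℝ → ℝ) (g : Torus → ℝ≥0∞) : Prop where
  aemeasurable : AEMeasurable g volume
  lintegral_lt_top : ∫⁻ x, g x < ∞
  lintegral_orlicz_lt_top : ∫⁻ x, orliczEval Φ (g x) < ∞

section

open Metric Set Filter Topology

/-! Up to constants, `a * |{Mf > a}|` is `∫_{|f| > a} |f|`: the Vitali covering lemma gives the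
upper bound (`mul_volume_maximalFunction_le`), and, with Lebesgue differentiation, the reverse bound
for `a` above the mean of `|f|` (`lintegral_le_mul_volume_maximalFunction`). Taking `a = 2 ^ k`,
multiplying by weights `w k` and summing shows, for integrable `f`, that `∑ w k * 2 ^ k * |{Mf > 2 ^
k}|` and `∑ w k * ∫_{|f| > 2 ^ k} |f|` are finite together. By Tonelli these are the integrals of
step functions of `Mf` and of `|f|`, so an Orlicz condition `Φ` on `Mf` matches `t * ψ t` on `|f|`
whenever, for `2 ^ n < t ≤ 2 ^ (n + 1)`, `Φ t` is comparable to `∑_{k ≤ n} w k * 2 ^ k` and `ψ t` to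
`∑_{k ≤ n} w k`. The weights are `k * log⁺ k` in part 1 and `log⁺ log⁺ log⁺ k / (k + 1)` in part 2.
Their iterated logarithms vary so slowly that they can be pulled out of the sums
(`eventually_sum_mul_comparison`). If `f` is not integrable then `Mf` is identically `∞`, so both
conditions on `Mf` fail. -/

lemma volume_torus_ball (x : Torus) (r : ℝ) :
    volume (ball x r) = ENNReal.ofReal (min (2 * π) (2 * r)) := by
  rw [← measure_congr AddCircle.closedBall_ae_eq_ball, AddCircle.volume_closedBall]

lemma volume_torus_ball_mul_le (x y : Torus) {c : ℝ} (hc : 1 ≤ c) (r : ℝ) :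
    volume (ball x (c * r)) ≤ ENNReal.ofReal c * volume (ball y r) := by
  rw [volume_torus_ball, volume_torus_ball, ← ENNReal.ofReal_mul (by linarith),
    mul_min_of_nonneg _ _ (by linarith : (0 : ℝ) ≤ c)]
  refine ENNReal.ofReal_le_ofReal (min_le_min ?_ (by linarith))
  nlinarith [Real.pi_pos]

lemma volume_torus_ball_ne_zero (x : Torus) {r : ℝ} (hr : 0 < r) : volume (ball x r) ≠ 0 :=
  (isOpen_ball.measure_pos volume ⟨x, mem_ball_self hr⟩).ne'

lemma torus_ball_eq_univ (x : Torus) {r : ℝ} (hr : π < r) : ball x r = univ := by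
  refine eq_univ_of_forall fun y => ?_
  rw [mem_ball, dist_eq_norm]
  refine (AddCircle.norm_le_half_period (2 * π) Real.two_pi_pos.ne').trans_lt ?_
  rwa [abs_of_pos Real.two_pi_pos, mul_div_cancel_left₀ _ two_ne_zero]

lemma volume_torus_univ : volume (univ : Set Torus) = ENNReal.ofReal (2 * π) :=
  AddCircle.measure_univ _

/-! ### Covering arguments, weak type estimates and measurability -/

/-- A consequence of the Vitali covering lemma: domination of measures on enlarged balls gives
domination of measures on the set of centres. -/
lemma measure_le_measure_biUnion_ball (μ ν : Measure Torus) (E : Set Torus) (r : Torus → ℝ)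
    (hr : ∀ x ∈ E, 0 < r x) (R : ℝ) (hR : ∀ x ∈ E, r x ≤ R)
    (h : ∀ x ∈ E, μ (ball x (5 * r x)) ≤ ν (ball x (r x))) :
    μ E ≤ ν (⋃ x ∈ E, ball x (r x)) := by
  obtain ⟨u, huE, hdisj, hcov⟩ := Vitali.exists_disjoint_subfamily_covering_enlargement_ball
    E id r R hR 5 (by norm_num)
  have hcount : u.Countable := hdisj.countable_of_isOpen (fun _ _ => isOpen_ball)
    fun x hx => ⟨x, mem_ball_self (hr x (huE hx))⟩
  calc μ E ≤ μ (⋃ x ∈ u, ball x (5 * r x)) := by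
        refine measure_mono fun x hx => ?_
        obtain ⟨b, hb, hsub⟩ := hcov x hx
        exact mem_iUnion₂.2 ⟨b, hb, hsub (mem_ball_self (hr x hx))⟩
    _ ≤ ∑' x : u, μ (ball (x : Torus) (5 * r x)) := measure_biUnion_le _ hcount _
    _ ≤ ∑' x : u, ν (ball (x : Torus) (r x)) :=
        ENNReal.tsum_le_tsum fun x => h x (huE x.2)
    _ = ν (⋃ x ∈ u, ball x (r x)) :=
        (measure_biUnion hcount hdisj fun _ _ => measurableSet_ball).symm
    _ ≤ ν (⋃ x ∈ E, ball x (r x)) := measure_mono (biUnion_mono huE fun _ _ => Subset.rfl)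

lemma lt_maximalFunction_iff {f : Torus → ℂ} {x : Torus} {a : ℝ≥0∞} :
    a < maximalFunction f x ↔
      ∃ r : ℝ, 0 < r ∧ a * volume (ball x r) < ∫⁻ y in ball x r, ‖f y‖ₑ := by
  simp only [maximalFunction, lt_iSup_iff, setLAverage_eq, exists_prop]
  refine exists_congr fun r => and_congr_right fun hr => ?_
  rw [ENNReal.lt_div_iff_mul_lt (Or.inl (volume_torus_ball_ne_zero x hr))
    (Or.inl measure_ball_lt_top.ne)]

/-- Beyond radius `π < 4` every ball is the whole torus. The covering lemma needs bounded radii. -/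
lemma exists_le_four_of_lt_maximalFunction {f : Torus → ℂ} {x : Torus} {a : ℝ≥0∞}
    (h : a < maximalFunction f x) :
    ∃ r : ℝ, 0 < r ∧ r ≤ 4 ∧ a * volume (ball x r) < ∫⁻ y in ball x r, ‖f y‖ₑ := by
  obtain ⟨r, hr, hlt⟩ := lt_maximalFunction_iff.1 h
  rcases le_or_gt r 4 with h4 | h4
  · exact ⟨r, hr, h4, hlt⟩
  · refine ⟨4, by norm_num, le_rfl, ?_⟩
    rwa [torus_ball_eq_univ x Real.pi_lt_four, ← torus_ball_eq_univ x (Real.pi_lt_four.trans h4)]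

/-- The weak type estimate `a |{Mf > 2a}| ≤ 5 ∫_{|f| > a} |f|`. -/
lemma mul_volume_maximalFunction_le (f : Torus → ℂ) (hf : AEStronglyMeasurable f volume)
    {a : ℝ≥0∞} (ha : a ≠ ∞) :
    a * volume {x | 2 * a < maximalFunction f x} ≤ 5 * ∫⁻ x in {x | a < ‖f x‖ₑ}, ‖f x‖ₑ := by
  have H : ∀ x, ∃ r : ℝ, x ∈ {x | 2 * a < maximalFunction f x} →
      0 < r ∧ r ≤ 4 ∧ 2 * a * volume (ball x r) < ∫⁻ y in ball x r, ‖f y‖ₑ := fun x => by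
    by_cases hx : 2 * a < maximalFunction f x
    · obtain ⟨r, hr⟩ := exists_le_four_of_lt_maximalFunction hx
      exact ⟨r, fun _ => hr⟩
    · exact ⟨0, fun h => (hx h).elim⟩
  choose r hr using H
  have hs : NullMeasurableSet {x | a < ‖f x‖ₑ} volume :=
    nullMeasurableSet_lt aemeasurable_const hf.enorm
  have key := measure_le_measure_biUnion_ball (a • volume)
    ((5 : ℝ≥0∞) • (volume.restrict {x | a < ‖f x‖ₑ}).withDensity fun x => ‖f x‖ₑ) _ r
    (fun x hx => (hr x hx).1) 4 (fun x hx => (hr x hx).2.1) fun x hx => by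
      obtain ⟨h0, -, h2⟩ := hr x hx
      simp only [Measure.smul_apply, smul_eq_mul]
      rw [withDensity_apply _ measurableSet_ball, Measure.restrict_restrict measurableSet_ball]
      -- The part of `f` below height `a` contributes at most `a * |B|`, hence less than half of the
      -- integral, which exceeds `2 * a * |B|`.
      have hsplit : ∫⁻ y in ball x (r x), ‖f y‖ₑ ≤
          (∫⁻ y in ball x (r x) ∩ {x | a < ‖f x‖ₑ}, ‖f y‖ₑ) + a * volume (ball x (r x)) := by
        calc ∫⁻ y in ball x (r x), ‖f y‖ₑ
            ≤ ∫⁻ y in ball x (r x), ({x | a < ‖f x‖ₑ}.indicator (fun x => ‖f x‖ₑ) y + a) := by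
              refine lintegral_mono fun y => ?_
              by_cases hy : y ∈ {x | a < ‖f x‖ₑ}
              · rw [indicator_of_mem hy]
                exact le_self_add
              · rw [indicator_of_notMem hy, zero_add]
                exact not_lt.1 hy
          _ = _ := by
              rw [lintegral_add_right _ measurable_const, setLIntegral_const,
                lintegral_indicator₀ (hs.mono_ac Measure.restrict_le_self.absolutelyContinuous),
                Measure.restrict_restrict₀
                  (hs.mono_ac Measure.restrict_le_self.absolutelyContinuous), inter_comm]
      have hlt := h2.trans_le hsplit
      have hfin : a * volume (ball x (r x)) ≠ ∞ :=
        ENNReal.mul_ne_top ha measure_ball_lt_top.ne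
      have hle : a * volume (ball x (r x)) ≤
          ∫⁻ y in ball x (r x) ∩ {x | a < ‖f x‖ₑ}, ‖f y‖ₑ := by
        rw [mul_assoc, two_mul] at hlt
        exact (ENNReal.add_le_add_iff_right hfin).1 hlt.le
      calc a * volume (ball x (5 * r x))
          ≤ a * (ENNReal.ofReal 5 * volume (ball x (r x))) := by
            gcongr
            exact volume_torus_ball_mul_le x x (by norm_num) _
        _ = 5 * (a * volume (ball x (r x))) := by
            rw [show ENNReal.ofReal 5 = 5 by norm_num]; ring
        _ ≤ _ := by gcongr
  simp only [Measure.smul_apply, smul_eq_mul] at key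
  refine key.trans ?_
  gcongr
  refine (measure_mono (subset_univ _)).trans ?_
  rw [withDensity_apply _ MeasurableSet.univ, Measure.restrict_univ]

/-- The reverse weak type estimate `∫_{|f| > a} |f| ≤ 5 a |{Mf > a / 2}|` for large `a`. -/
lemma lintegral_le_mul_volume_maximalFunction (f : Torus → ℂ)
    (hf : AEStronglyMeasurable f volume) {a : ℝ≥0∞} (ha : a ≠ ∞)
    (hfa : ∫⁻ x, ‖f x‖ₑ ≤ a * volume (univ : Set Torus)) :
    ∫⁻ x in {x | a < ‖f x‖ₑ}, ‖f x‖ₑ ≤ 5 * a * volume {x | a / 2 < maximalFunction f x} := by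
  have hfin : ∫⁻ x, ‖f x‖ₑ ≠ ∞ :=
    (hfa.trans_lt (ENNReal.mul_lt_top ha.lt_top (measure_lt_top _ _))).ne
  set S : Torus → Set ℝ := fun x =>
    {r | 0 < r ∧ a * volume (ball x r) < ∫⁻ y in ball x r, ‖f y‖ₑ} with hS
  -- A radius beyond `π` would make the mean over the whole torus exceed `a`, against `hfa`.
  have hSbdd : ∀ x, ∀ r ∈ S x, r ≤ π := by
    intro x r hr
    by_contra! hlt
    have := hr.2
    rw [torus_ball_eq_univ x hlt, setLIntegral_univ] at this
    exact absurd hfa (not_le.2 this)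
  set E : Set Torus := {x | (S x).Nonempty} with hE
  have H : ∀ x, ∃ r : ℝ, x ∈ E → r ∈ S x ∧ 5 * r ∉ S x := fun x => by
    by_cases hx : x ∈ E
    · have hb : BddAbove (S x) := ⟨π, hSbdd x⟩
      obtain ⟨r0, hr0⟩ := hx
      have hpos : 0 < sSup (S x) := hr0.1.trans_le (le_csSup hb hr0)
      -- A nearly maximal radius: `r` is admissible but `5 * r` is above the supremum, so the mean
      -- over the enlarged ball is at most `a`.
      obtain ⟨r, hr, hlt⟩ := exists_lt_of_lt_csSup ⟨r0, hr0⟩ (half_lt_self hpos)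
      refine ⟨r, fun _ => ⟨hr, fun h5 => ?_⟩⟩
      have := le_csSup hb h5
      linarith
    · exact ⟨0, fun h => (hx h).elim⟩
  choose r hr using H
  have key := measure_le_measure_biUnion_ball (volume.withDensity fun x => ‖f x‖ₑ)
    ((5 * a) • volume) E r (fun x hx => (hr x hx).1.1) π (fun x hx => hSbdd x _ (hr x hx).1)
    fun x hx => by
      obtain ⟨⟨h0, h1⟩, h2⟩ := hr x hx
      have h3 : ∫⁻ y in ball x (5 * r x), ‖f y‖ₑ ≤ a * volume (ball x (5 * r x)) := by
        by_contra! hlt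
        exact h2 ⟨by linarith, hlt⟩
      rw [withDensity_apply _ measurableSet_ball, Measure.smul_apply, smul_eq_mul]
      refine h3.trans ?_
      calc a * volume (ball x (5 * r x))
          ≤ a * (ENNReal.ofReal 5 * volume (ball x (r x))) := by
            gcongr
            exact volume_torus_ball_mul_le x x (by norm_num) _
        _ = 5 * a * volume (ball x (r x)) := by
            rw [show ENNReal.ofReal 5 = 5 by norm_num]; ring
  -- For `y ∈ B(x, r)`, the ball `B(y, 2r)` contains `B(x, r)` and has at most twice its measure,
  -- whence the level `a / 2`.
  have hsub : ⋃ x ∈ E, ball x (r x) ⊆ {x | a / 2 < maximalFunction f x} := by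
    refine iUnion₂_subset fun x hx y hy => ?_
    obtain ⟨⟨h0, h1⟩, -⟩ := hr x hx
    refine lt_maximalFunction_iff.2 ⟨2 * r x, by linarith, ?_⟩
    calc a / 2 * volume (ball y (2 * r x))
        ≤ a / 2 * (ENNReal.ofReal 2 * volume (ball x (r x))) := by
          gcongr
          exact volume_torus_ball_mul_le y x (by norm_num) _
      _ = a * volume (ball x (r x)) := by
          rw [show ENNReal.ofReal 2 = 2 by norm_num, ← mul_assoc,
            ENNReal.div_mul_cancel two_ne_zero ENNReal.ofNat_ne_top]
      _ < ∫⁻ y in ball x (r x), ‖f y‖ₑ := h1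
      _ ≤ ∫⁻ z in ball y (2 * r x), ‖f z‖ₑ := by
          refine lintegral_mono_set (ball_subset_ball' ?_)
          rw [mem_ball, dist_comm] at hy
          linarith
  -- Lebesgue differentiation: at almost every point with `|f| > a`, small balls have mean above
  -- `a`.
  have hae : ∀ᵐ x ∂(volume : Measure Torus), a < ‖f x‖ₑ → x ∈ E := by
    have hdiff := (IsUnifLocDoublingMeasure.vitaliFamily
      (volume : Measure Torus) 1).ae_tendsto_lintegral_div hf.enorm hfin
    filter_upwards [hdiff] with x hx hlt
    have ht : Tendsto (fun r : ℝ => closedBall x r) (𝓝[>] 0)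
        ((IsUnifLocDoublingMeasure.vitaliFamily (volume : Measure Torus) 1).filterAt x) := by
      refine IsUnifLocDoublingMeasure.tendsto_closedBall_filterAt _ (fun _ => x) (fun r => r)
        tendsto_id ?_
      filter_upwards [self_mem_nhdsWithin] with r hr
      exact mem_closedBall_self (by simpa using (mem_Ioi.1 hr).le)
    have hev := (hx.comp ht).eventually (lt_mem_nhds hlt)
    obtain ⟨r, hr1, hr2⟩ := (hev.and self_mem_nhdsWithin).exists
    refine ⟨r, hr2, ?_⟩
    simp only [Function.comp] at hr1
    rw [measure_congr AddCircle.closedBall_ae_eq_ball,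
      setLIntegral_congr AddCircle.closedBall_ae_eq_ball, ENNReal.lt_div_iff_mul_lt
      (Or.inl (volume_torus_ball_ne_zero x hr2)) (Or.inl measure_ball_lt_top.ne)] at hr1
    exact hr1
  calc ∫⁻ x in {x | a < ‖f x‖ₑ}, ‖f x‖ₑ
      ≤ (volume.withDensity fun x => ‖f x‖ₑ) {x | a < ‖f x‖ₑ} := withDensity_apply_le _ _
    _ ≤ (volume.withDensity fun x => ‖f x‖ₑ) E :=
        measure_mono_ae ((withDensity_absolutelyContinuous _ _).ae_le hae)
    _ ≤ 5 * a * volume (⋃ x ∈ E, ball x (r x)) := by simpa using key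
    _ ≤ _ := by gcongr

/-- Lower semicontinuity: the strict inequality for `B(x, r)` survives a slight shrinking of the
domain of integration, and the shrunk ball lies in `B(y, r)` for `y` near `x`, a ball of the same
measure. -/
lemma measurable_maximalFunction (f : Torus → ℂ) : Measurable (maximalFunction f) := by
  refine LowerSemicontinuous.measurable fun x a hxa => ?_
  obtain ⟨r, hr, hlt⟩ := lt_maximalFunction_iff.1 hxa
  have hlim : Tendsto (fun n : ℕ => ∫⁻ y in ball x (r - 1 / (n + 1 : ℝ)), ‖f y‖ₑ) atTop
      (𝓝 (∫⁻ y in ball x r, ‖f y‖ₑ)) := by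
    have hU : ⋃ n : ℕ, ball x (r - 1 / (n + 1 : ℝ)) = ball x r := by
      refine Subset.antisymm (iUnion_subset fun n => ball_subset_ball ?_) fun y hy => ?_
      · linarith [Nat.one_div_pos_of_nat (α := ℝ) (n := n)]
      · obtain ⟨n, hn⟩ := exists_nat_one_div_lt (sub_pos.2 (mem_ball.1 hy))
        exact mem_iUnion.2 ⟨n, mem_ball.2 (by linarith)⟩
    have hmono : Monotone fun n : ℕ => ball x (r - 1 / (n + 1 : ℝ)) := fun m n hmn =>
      ball_subset_ball (by linarith [Nat.one_div_le_one_div (α := ℝ) hmn])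
    have := tendsto_measure_iUnion_atTop (μ := volume.withDensity fun y => ‖f y‖ₑ) hmono
    simpa only [hU, Function.comp_def, withDensity_apply _ measurableSet_ball] using this
  obtain ⟨n, hn⟩ := (hlim.eventually (lt_mem_nhds hlt)).exists
  filter_upwards [ball_mem_nhds x (Nat.one_div_pos_of_nat (α := ℝ) (n := n))] with y hy
  refine lt_maximalFunction_iff.2 ⟨r, hr, ?_⟩
  rw [volume_torus_ball, ← volume_torus_ball x]
  refine hn.trans_le (lintegral_mono_set (ball_subset_ball' ?_))
  rw [mem_ball, dist_comm] at hy
  linarith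

lemma maximalFunction_eq_top {f : Torus → ℂ} (h : ∫⁻ x, ‖f x‖ₑ = ∞) (x : Torus) :
    maximalFunction f x = ∞ := by
  by_contra hne
  refine lt_irrefl _ (lt_maximalFunction_iff.2 ⟨4, by norm_num, ?_⟩ :
    maximalFunction f x < maximalFunction f x)
  rw [torus_ball_eq_univ x Real.pi_lt_four, setLIntegral_univ, h]
  exact ENNReal.mul_lt_top (Ne.lt_top hne) (measure_lt_top _ _)

/-! ### Dyadic step functions and comparison with partial sums -/

/-- The step function of `t` that sums those `v k` with `2 ^ k < t`. -/
noncomputable def dyadicSum (v : ℕ → ℝ) (t : ℝ≥0∞) : ℝ≥0∞ :=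
  ∑' k, (Ioi ((2 : ℝ≥0∞) ^ k)).indicator (fun _ => ENNReal.ofReal (v k)) t

lemma dyadicSum_mono (v : ℕ → ℝ) : Monotone (dyadicSum v) := fun s t hst => by
  refine ENNReal.tsum_le_tsum fun k => ?_
  by_cases hs : s ∈ Ioi ((2 : ℝ≥0∞) ^ k)
  · rw [indicator_of_mem hs, indicator_of_mem (mem_Ioi.2 (lt_of_lt_of_le hs hst))]
  · rw [indicator_of_notMem hs]
    exact zero_le

lemma dyadicSum_ofReal {v : ℕ → ℝ} (hv : ∀ k, 0 ≤ v k) {n : ℕ} {t : ℝ}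
    (ht : t ∈ Ioc ((2 : ℝ) ^ n) (2 ^ (n + 1))) :
    dyadicSum v (ENNReal.ofReal t) = ENNReal.ofReal (∑ k ∈ Finset.range (n + 1), v k) := by
  have hiff : ∀ k, ENNReal.ofReal t ∈ Ioi ((2 : ℝ≥0∞) ^ k) ↔ k < n + 1 := fun k => by
    have h2 : (2 : ℝ≥0∞) ^ k = ENNReal.ofReal ((2 : ℝ) ^ k) := by
      rw [ENNReal.ofReal_pow zero_le_two, ENNReal.ofReal_ofNat]
    rw [mem_Ioi, h2, ENNReal.ofReal_lt_ofReal_iff (lt_trans (by positivity) ht.1)]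
    constructor
    · intro h
      exact (pow_lt_pow_iff_right₀ one_lt_two).1 (h.trans_le ht.2)
    · intro h
      exact (pow_le_pow_right₀ one_le_two (Nat.lt_succ_iff.1 h)).trans_lt ht.1
  rw [ENNReal.ofReal_sum_of_nonneg fun k _ => hv k, dyadicSum,
    tsum_eq_sum (s := Finset.range (n + 1))]
  · refine Finset.sum_congr rfl fun k hk => ?_
    rw [indicator_of_mem ((hiff k).2 (Finset.mem_range.1 hk))]
  · intro k hk
    rw [indicator_of_notMem fun h => hk (Finset.mem_range.2 ((hiff k).1 h))]

lemma exists_mem_Ioc_two_pow {N : ℕ} {t : ℝ} (ht : 2 ^ N < t) :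
    ∃ n, N ≤ n ∧ t ∈ Ioc ((2 : ℝ) ^ n) (2 ^ (n + 1)) := by
  have hex : ∃ m : ℕ, t ≤ 2 ^ m :=
    (pow_unbounded_of_one_lt t one_lt_two).imp fun _ h => h.le
  classical
  have hN : N < Nat.find hex := by
    by_contra! hle
    exact absurd ht (not_lt.2 ((Nat.find_spec hex).trans (pow_le_pow_right₀ one_le_two hle)))
  refine ⟨Nat.find hex - 1, by omega, not_le.1 (Nat.find_min hex (by omega)), ?_⟩
  rw [Nat.sub_add_cancel (by omega)]
  exact Nat.find_spec hex

/-- The added `1` absorbs the bounded range of `t`. It is harmless later because the torus has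
finite measure and `f` is integrable. -/
lemma exists_dyadicSum_comparison {v : ℕ → ℝ} (hv : ∀ k, 0 ≤ v k) {b : ℝ → ℝ}
    (hb : ∀ R, ∃ K, ∀ t ∈ Icc 0 R, b t ≤ K) {C : ℝ} (hC : 0 ≤ C)
    (h : ∀ᶠ n : ℕ in atTop, ∀ t ∈ Ioc ((2 : ℝ) ^ n) (2 ^ (n + 1)),
      b t ≤ C * ∑ k ∈ Finset.range (n + 1), v k ∧
      ∑ k ∈ Finset.range (n + 1), v k ≤ C * b t) :
    ∃ K : ℝ≥0∞, K ≠ ∞ ∧ ∀ t : ℝ, 0 ≤ t →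
      ENNReal.ofReal (b t) ≤ K * (1 + dyadicSum v (ENNReal.ofReal t)) ∧
      dyadicSum v (ENNReal.ofReal t) ≤ K * (1 + ENNReal.ofReal (b t)) := by
  obtain ⟨N, hN⟩ := eventually_atTop.1 h
  obtain ⟨B, hB⟩ := hb (2 ^ (N + 1))
  have hD : dyadicSum v (ENNReal.ofReal (2 ^ (N + 1))) ≠ ∞ := by
    rw [dyadicSum_ofReal hv (n := N) ⟨pow_lt_pow_right₀ one_lt_two (Nat.lt_succ_self N), le_rfl⟩]
    exact ENNReal.ofReal_ne_top
  refine ⟨ENNReal.ofReal (C) + ENNReal.ofReal B +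
    dyadicSum v (ENNReal.ofReal (2 ^ (N + 1))), 
    ENNReal.add_ne_top.2 ⟨ENNReal.add_ne_top.2 ⟨ENNReal.ofReal_ne_top, ENNReal.ofReal_ne_top⟩, hD⟩,
    fun t ht => ?_⟩
  rcases le_or_gt t (2 ^ N) with htN | htN
  · have htN' : t ≤ 2 ^ (N + 1) := htN.trans (pow_le_pow_right₀ one_le_two (Nat.le_succ N))
    constructor
    · calc ENNReal.ofReal (b t) ≤ ENNReal.ofReal B * 1 := by
            rw [mul_one]; exact ENNReal.ofReal_le_ofReal (hB t ⟨ht, htN'⟩)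
        _ ≤ _ := mul_le_mul' (le_add_right le_add_self) le_self_add
    · calc dyadicSum v (ENNReal.ofReal t)
          ≤ dyadicSum v (ENNReal.ofReal (2 ^ (N + 1))) * 1 := by
            rw [mul_one]; exact dyadicSum_mono v (ENNReal.ofReal_le_ofReal htN')
        _ ≤ _ := mul_le_mul' le_add_self le_self_add
  · obtain ⟨n, hn, htn⟩ := exists_mem_Ioc_two_pow htN
    obtain ⟨h1, h2⟩ := hN n hn t htn
    rw [dyadicSum_ofReal hv htn]
    have hs : 0 ≤ ∑ k ∈ Finset.range (n + 1), v k := Finset.sum_nonneg fun k _ => hv k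
    constructor
    · calc ENNReal.ofReal (b t)
          ≤ ENNReal.ofReal (C * ∑ k ∈ Finset.range (n + 1), v k) :=
            ENNReal.ofReal_le_ofReal h1
        _ = ENNReal.ofReal (C) * ENNReal.ofReal (∑ k ∈ Finset.range (n + 1), v k) :=
            ENNReal.ofReal_mul hC
        _ ≤ _ := mul_le_mul' (le_add_right le_self_add) le_add_self
    · calc ENNReal.ofReal (∑ k ∈ Finset.range (n + 1), v k)
          ≤ ENNReal.ofReal (C * max (b t) 0) := by
            exact ENNReal.ofReal_le_ofReal (h2.trans (by gcongr; exact le_max_left _ _))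
        _ = ENNReal.ofReal (C) * ENNReal.ofReal (b t) := by
            rw [ENNReal.ofReal_mul hC]; simp
        _ ≤ _ := mul_le_mul' (le_add_right le_self_add) le_add_self

lemma nat_mul_half_le_posLog {n : ℕ} {t : ℝ} (ht : t ∈ Ioc ((2 : ℝ) ^ n) (2 ^ (n + 1))) :
    (n : ℝ) / 2 ≤ Real.posLog t ∧ Real.posLog t ≤ n + 1 ∧ Real.posLog t = Real.log t := by
  have h1 : (1 : ℝ) ≤ 2 ^ n := one_le_pow₀ one_le_two
  have ht0 : 0 < t := by linarith [ht.1]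
  have heq : Real.posLog t = Real.log t :=
    Real.posLog_eq_log (by rw [abs_of_pos ht0]; linarith [ht.1])
  have hl := Real.log_two_gt_d9
  have hl' := Real.log_two_lt_d9
  have ha := Real.log_le_log (by positivity) ht.1.le
  have hb := Real.log_le_log ht0 ht.2
  rw [Real.log_pow] at ha hb
  push_cast at hb
  have hn : (0 : ℝ) ≤ n := n.cast_nonneg
  exact ⟨by rw [heq]; nlinarith, by rw [heq]; nlinarith, heq⟩

/-- Summation against a function `h` of very slow growth. -/
lemma eventually_sum_mul_comparison {u : ℕ → ℝ} (hu : ∀ k, 0 ≤ u k) {h : ℝ → ℝ}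
    (hmono : MonotoneOn h (Ici 0)) (h0 : ∀ x, 0 ≤ h x)
    (hsq : ∀ᶠ x : ℝ in atTop, h (x ^ 2) ≤ 2 * h x)
    (hU : ∀ᶠ n : ℕ in atTop, ∑ k ∈ Finset.range (n.sqrt + 1), u k ≤
      3 / 4 * ∑ k ∈ Finset.range (n + 1), u k)
    {β : ℝ → ℝ} {C : ℝ} (hC : 0 ≤ C)
    (hβ : ∀ᶠ n : ℕ in atTop, ∀ t ∈ Ioc ((2 : ℝ) ^ n) (2 ^ (n + 1)),
      β t ≤ C * ∑ k ∈ Finset.range (n + 1), u k ∧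
      ∑ k ∈ Finset.range (n + 1), u k ≤ C * β t) :
    ∀ᶠ n : ℕ in atTop, ∀ t ∈ Ioc ((2 : ℝ) ^ n) (2 ^ (n + 1)),
      β t * h (Real.posLog t) ≤ (32 * C) * ∑ k ∈ Finset.range (n + 1), u k * h k ∧
      ∑ k ∈ Finset.range (n + 1), u k * h k ≤ (32 * C) * (β t * h (Real.posLog t)) := by
  obtain ⟨X, hX⟩ := eventually_atTop.1 hsq
  obtain ⟨M, hM⟩ := exists_nat_ge (max X 3)
  have hMX : X ≤ M := (le_max_left _ _).trans hM
  have hM3 : 3 ≤ M := by exact_mod_cast (le_max_right _ _).trans hM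
  -- The threshold makes `√n ≥ M`, `l ≥ n / 2 ≥ M` and `n ≥ 4`, so that `h (x ^ 2) ≤ 2 * h x`
  -- applies at `n`, `l`, `m` and `m ^ 2`.
  filter_upwards [hU, hβ, eventually_ge_atTop (M ^ 2 + 2 * M + 4)] with n hUn hβn hn t ht
  obtain ⟨h1, h2⟩ := hβn t ht
  obtain ⟨hl1, hl2, -⟩ := nat_mul_half_le_posLog ht
  set l := Real.posLog t
  set U := ∑ k ∈ Finset.range (n + 1), u k
  set s := ∑ k ∈ Finset.range (n + 1), u k * h k
  set m := n.sqrt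
  have hmM : M ≤ m := Nat.le_sqrt'.2 (by nlinarith)
  have hnm : n < (m + 1) ^ 2 := Nat.lt_succ_sqrt' n
  have hm2 : m ^ 2 ≤ n := Nat.sqrt_le' n
  have hmn : m ≤ n := Nat.sqrt_le_self n
  have hnR : ((M : ℝ) ^ 2 + 2 * M + 4) ≤ n := by exact_mod_cast hn
  have hM3R : (3 : ℝ) ≤ M := by exact_mod_cast hM3
  have hmMR : (M : ℝ) ≤ m := by exact_mod_cast hmM
  have hnmR : (n : ℝ) ≤ (m + 1) ^ 2 := by exact_mod_cast hnm.le
  have hU0 : 0 ≤ U := Finset.sum_nonneg fun k _ => hu k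
  have hl0 : 0 ≤ l := Real.posLog_nonneg
  have hln : h l ≤ 2 * h n := by
    refine (hmono hl0 (sq_nonneg (n : ℝ)) ?_).trans (hX n (by nlinarith))
    nlinarith
  have hnl : h n ≤ 2 * h l := by
    refine (hmono (mem_Ici.2 n.cast_nonneg) (sq_nonneg l) ?_).trans (hX l (by nlinarith))
    nlinarith
  -- Two squarings suffice, as `n ≤ (m + 1) ^ 2 ≤ m ^ 4`.
  have hnm' : h n ≤ 4 * h m := by
    have e1 := hX m (by linarith)
    have e2 := hX ((m : ℝ) ^ 2) (by nlinarith)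
    have e3 : h n ≤ h (((m : ℝ) ^ 2) ^ 2) := by
      refine hmono (mem_Ici.2 n.cast_nonneg) (sq_nonneg ((m : ℝ) ^ 2)) (hnmR.trans ?_)
      have : (m : ℝ) + 1 ≤ (m : ℝ) ^ 2 := by nlinarith
      exact pow_le_pow_left₀ (by positivity) this 2
    linarith
  have hs1 : s ≤ h n * U := by
    rw [Finset.mul_sum]
    refine Finset.sum_le_sum fun k hk => ?_
    rw [mul_comm]
    refine mul_le_mul_of_nonneg_right (hmono (mem_Ici.2 k.cast_nonneg) (mem_Ici.2 n.cast_nonneg) ?_) (hu k)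
    exact_mod_cast Nat.lt_succ_iff.1 (Finset.mem_range.1 hk)
  -- Only the terms with `k > √n` are kept. There `h k ≥ h m`, and by `hUn` they carry at least a
  -- quarter of `U`.
  have hs2 : h m * (U - ∑ k ∈ Finset.range (m + 1), u k) ≤ s := by
    rw [← Finset.sum_Ico_eq_sub _ (by omega : m + 1 ≤ n + 1), Finset.mul_sum]
    calc ∑ k ∈ Finset.Ico (m + 1) (n + 1), h m * u k
        ≤ ∑ k ∈ Finset.Ico (m + 1) (n + 1), u k * h k := by
          refine Finset.sum_le_sum fun k hk => ?_
          rw [mul_comm]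
          refine mul_le_mul_of_nonneg_left (hmono (mem_Ici.2 m.cast_nonneg) (mem_Ici.2 k.cast_nonneg) ?_) (hu k)
          have := (Finset.mem_Ico.1 hk).1
          exact_mod_cast (by omega : m ≤ k)
      _ ≤ s := Finset.sum_le_sum_of_subset_of_nonneg
          (fun k hk => Finset.mem_range.2 (Finset.mem_Ico.1 hk).2)
          fun k _ _ => mul_nonneg (hu k) (h0 k)
  have hs3 : h m * U ≤ 4 * s := by
    have := mul_le_mul_of_nonneg_left hUn (h0 m)
    linarith
  constructor
  · calc β t * h l ≤ (C * U) * (8 * h m) := by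
          refine mul_le_mul h1 (by linarith) (h0 l) (by positivity)
      _ = 8 * C * (h m * U) := by ring
      _ ≤ 8 * C * (4 * s) := by gcongr
      _ = 32 * C * s := by ring
  · have hβ0 : 0 ≤ C * β t := hU0.trans h2
    calc s ≤ h n * U := hs1
      _ ≤ (2 * h l) * (C * β t) := mul_le_mul hnl h2 hU0 (by linarith [h0 l])
      _ = 2 * ((C * β t) * h l) := by ring
      _ ≤ 32 * ((C * β t) * h l) := by
          have := mul_nonneg hβ0 (h0 l)
          linarith
      _ = 32 * C * (β t * h l) := by ring

/-! ### Slow growth of iterated logarithms and model sums -/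

lemma tendsto_posLog_atTop : Tendsto Real.posLog atTop atTop :=
  tendsto_atTop_mono (fun _ => le_max_right _ _) Real.tendsto_log_atTop

lemma posLog_sq (x : ℝ) : Real.posLog (x ^ 2) = 2 * Real.posLog x := by
  simp

lemma posLog_two_mul_le {x : ℝ} (hx : 2 ≤ x) : Real.posLog (2 * x) ≤ 2 * Real.posLog x := by
  rw [← posLog_sq]
  exact Real.posLog_le_posLog (by linarith) (by nlinarith)

/-- The threefold iterate of `log⁺`. -/
noncomputable def posLogThree (x : ℝ) : ℝ := Real.posLog (Real.posLog (Real.posLog x))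

lemma posLogThree_nonneg (x : ℝ) : 0 ≤ posLogThree x := Real.posLog_nonneg

lemma continuous_posLogThree : Continuous posLogThree := by
  unfold posLogThree; fun_prop

lemma monotoneOn_posLogThree : MonotoneOn posLogThree (Ici 0) := fun _ hx _ _ hxy =>
  Real.posLog_le_posLog Real.posLog_nonneg
    (Real.posLog_le_posLog Real.posLog_nonneg (Real.posLog_le_posLog hx hxy))

lemma eventually_posLogThree_sq_le : ∀ᶠ x : ℝ in atTop, posLogThree (x ^ 2) ≤ 2 * posLogThree x := by
  filter_upwards [tendsto_posLog_atTop.eventually_ge_atTop 2,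
    (tendsto_posLog_atTop.comp tendsto_posLog_atTop).eventually_ge_atTop 2] with x h1 h2
  rw [posLogThree, posLog_sq]
  refine le_trans (Real.posLog_le_posLog Real.posLog_nonneg (posLog_two_mul_le h1)) ?_
  exact posLog_two_mul_le h2

/-- For sums of geometric growth the last term is at least a quarter of the total, and stopping at
`√n < n` loses it. -/
lemma sum_sqrt_le_of_le {u : ℕ → ℝ} (hu : ∀ k, 0 ≤ u k)
    (h : ∀ᶠ n : ℕ in atTop, ∑ k ∈ Finset.range (n + 1), u k ≤ 4 * u n) :
    ∀ᶠ n : ℕ in atTop, ∑ k ∈ Finset.range (n.sqrt + 1), u k ≤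
      3 / 4 * ∑ k ∈ Finset.range (n + 1), u k := by
  filter_upwards [h, eventually_ge_atTop 2] with n hn h2
  have hlt : n.sqrt < n := Nat.sqrt_lt_self h2
  have h3 : ∑ k ∈ Finset.range (n.sqrt + 1), u k ≤ ∑ k ∈ Finset.range n, u k :=
    Finset.sum_le_sum_of_subset_of_nonneg (Finset.range_mono (by omega)) fun k _ _ => hu k
  rw [Finset.sum_range_succ] at hn
  rw [Finset.sum_range_succ u n]
  linarith

lemma sum_mul_two_pow_le (n : ℕ) :
    ∑ k ∈ Finset.range (n + 1), (k : ℝ) * 2 ^ k ≤ 2 * (n * 2 ^ n) := by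
  induction n with
  | zero => simp
  | succ n ih =>
    rw [Finset.sum_range_succ]
    push_cast
    rw [pow_succ]
    have : (0 : ℝ) < 2 ^ n := by positivity
    nlinarith

lemma sum_one_div_mul_two_pow_le (n : ℕ) :
    ∑ k ∈ Finset.range (n + 1), 1 / ((k : ℝ) + 1) * 2 ^ k ≤ 4 * (1 / ((n : ℝ) + 1) * 2 ^ n) := by
  induction n with
  | zero => norm_num
  | succ n ih =>
    rcases Nat.eq_zero_or_pos n with rfl | hn
    · norm_num [Finset.sum_range_succ]
    rw [Finset.sum_range_succ]
    refine (add_le_add_left ih _).trans ?_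
    have hn1 : (1 : ℝ) ≤ n := by exact_mod_cast hn
    have h2 : (0 : ℝ) < 2 ^ n := by positivity
    -- This ratio bound needs `n ≥ 1`. It closes the induction exactly: `4 * (3 / 2) + 4 * 2 - 8 + 2
    -- = 4 * 2`.
    have : 1 / ((n : ℝ) + 1) ≤ 3 / 2 * (1 / ((n : ℝ) + 2)) := by
      rw [mul_one_div, div_le_div_iff₀ (by positivity) (by positivity)]
      linarith
    push_cast
    rw [pow_succ, show (n : ℝ) + 1 + 1 = n + 2 by ring]
    nlinarith

lemma harmonic_real (n : ℕ) :
    ∑ k ∈ Finset.range n, 1 / ((k : ℝ) + 1) = ((harmonic n : ℚ) : ℝ) := by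
  simp [harmonic]

/-! ### Summing the weak type estimates over dyadic levels -/

lemma ENNReal.tsum_ne_top_of_eventually_succ_le {a b : ℕ → ℝ≥0∞} (ha : ∀ k, a k ≠ ∞)
    {C : ℝ≥0∞} (hC : C ≠ ∞) (h : ∀ᶠ k in atTop, a (k + 1) ≤ C * b k) (hb : ∑' k, b k ≠ ∞) :
    ∑' k, a k ≠ ∞ := by
  obtain ⟨N, hN⟩ := eventually_atTop.1 h
  rw [← Summable.sum_add_tsum_nat_add' (k := N + 1) ENNReal.summable]
  refine ENNReal.add_ne_top.2 ⟨ENNReal.sum_ne_top.2 fun k _ => ha k, ne_top_of_le_ne_top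
    (ENNReal.mul_ne_top hC hb) ?_⟩
  calc ∑' k, a (k + (N + 1)) ≤ ∑' k, C * b (k + N) :=
        ENNReal.tsum_le_tsum fun k => hN (k + N) (by omega)
    _ = C * ∑' k, b (k + N) := ENNReal.tsum_mul_left
    _ ≤ C * ∑' k, b k := by
        exact mul_le_mul' le_rfl
          (ENNReal.tsum_comp_le_tsum_of_injective (add_left_injective N) b)

lemma lintegral_mul_dyadicSum (v : ℕ → ℝ) {φ g : Torus → ℝ≥0∞} (hφ : AEMeasurable φ volume)
    (hg : AEMeasurable g volume) :
    ∫⁻ x, φ x * dyadicSum v (g x) =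
      ∑' k, ENNReal.ofReal (v k) * ∫⁻ x in {x | 2 ^ k < g x}, φ x := by
  have hset : ∀ k : ℕ, NullMeasurableSet {x | 2 ^ k < g x} volume := fun k =>
    nullMeasurableSet_lt aemeasurable_const hg
  have heq : ∀ x, φ x * dyadicSum v (g x) =
      ∑' k : ℕ, ENNReal.ofReal (v k) * {x | 2 ^ k < g x}.indicator φ x := fun x => by
    rw [dyadicSum, ← ENNReal.tsum_mul_left]
    refine tsum_congr fun k => ?_
    by_cases hx : 2 ^ k < g x
    · rw [indicator_of_mem (mem_Ioi.2 hx), indicator_of_mem (show x ∈ {x | 2 ^ k < g x} from hx),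
        mul_comm]
    · rw [indicator_of_notMem (fun h => hx (mem_Ioi.1 h)),
        indicator_of_notMem (show x ∉ {x | 2 ^ k < g x} from hx), mul_zero, mul_zero]
  simp_rw [heq]
  rw [lintegral_tsum fun k => (hφ.indicator₀ (hset k)).const_mul _]
  refine tsum_congr fun k => ?_
  rw [lintegral_const_mul' _ _ ENNReal.ofReal_ne_top, lintegral_indicator₀ (hset k)]

/-- The weak type estimate bounds `n * |{Mf = ∞}|` by `5 * ∫ |f|` for every `n`. -/
lemma ae_maximalFunction_ne_top (f : Torus → ℂ) (hf : AEStronglyMeasurable f volume)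
    (hfi : ∫⁻ x, ‖f x‖ₑ ≠ ∞) : ∀ᵐ x, maximalFunction f x ≠ ∞ := by
  rw [ae_iff]
  simp only [not_not]
  by_contra hne
  obtain ⟨n, hn⟩ := ENNReal.exists_nat_mul_gt hne
    (ENNReal.mul_ne_top (ENNReal.ofNat_ne_top (n := 5)) hfi)
  refine absurd hn (not_lt.2 ?_)
  calc n * volume {x | maximalFunction f x = ∞}
      ≤ n * volume {x | 2 * (n : ℝ≥0∞) < maximalFunction f x} := by
        gcongr with x
        intro hx
        rw [hx]
        exact ENNReal.mul_lt_top (by simp) (by simp)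
    _ ≤ 5 * ∫⁻ x in {x | (n : ℝ≥0∞) < ‖f x‖ₑ}, ‖f x‖ₑ :=
        mul_volume_maximalFunction_le f hf (by simp)
    _ ≤ 5 * ∫⁻ x, ‖f x‖ₑ := by
        gcongr
        exact Measure.restrict_le_self

/-- The two weak type estimates, summed over dyadic levels with weights. -/
lemma lintegral_dyadicSum_maximalFunction_ne_top_iff (f : Torus → ℂ)
    (hf : AEStronglyMeasurable f volume) (hfi : ∫⁻ x, ‖f x‖ₑ ≠ ∞) {w : ℕ → ℝ}
    (hw : ∀ᶠ k in atTop, w (k + 1) ≤ 4 * w k) :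
    ∫⁻ x, dyadicSum (fun k => w k * 2 ^ k) (maximalFunction f x) ≠ ∞ ↔
      ∫⁻ x, ‖f x‖ₑ * dyadicSum w ‖f x‖ₑ ≠ ∞ := by
  have hM := lintegral_mul_dyadicSum (fun k => w k * 2 ^ k) (φ := fun _ => 1) aemeasurable_const
    (measurable_maximalFunction f).aemeasurable
  simp only [one_mul, lintegral_const, Measure.restrict_apply_univ] at hM
  rw [hM, lintegral_mul_dyadicSum w hf.enorm hf.enorm]
  have hpow : ∀ k, ENNReal.ofReal (w k * 2 ^ k) = ENNReal.ofReal (w k) * 2 ^ k := fun k => by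
    rw [ENNReal.ofReal_mul' (by positivity), ENNReal.ofReal_pow zero_le_two, ENNReal.ofReal_ofNat]
  have hw' : ∀ᶠ k in atTop, ENNReal.ofReal (w (k + 1)) ≤ 4 * ENNReal.ofReal (w k) := by
    filter_upwards [hw] with k hk
    calc ENNReal.ofReal (w (k + 1)) ≤ ENNReal.ofReal (4 * w k) := ENNReal.ofReal_le_ofReal hk
      _ = 4 * ENNReal.ofReal (w k) := by
        rw [ENNReal.ofReal_mul (by norm_num), ENNReal.ofReal_ofNat]
  have h2 : ∀ k : ℕ, (2 : ℝ≥0∞) ^ k ≠ ∞ := fun k => ENNReal.pow_ne_top ENNReal.ofNat_ne_top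
  simp_rw [hpow]
  constructor
  -- Here `40 = 4 * 5 * 2`: growth of the weights, covering constant, and the shift from `2 ^ (k +
  -- 1)` to `2 ^ k`.
  · refine ENNReal.tsum_ne_top_of_eventually_succ_le (C := 40) (fun k => ?_)
      ENNReal.ofNat_ne_top ?_
    · exact ENNReal.mul_ne_top ENNReal.ofReal_ne_top
        (ne_top_of_le_ne_top hfi (setLIntegral_le_lintegral _ _))
    · have hbig : ∀ᶠ k : ℕ in atTop,
          ∫⁻ x, ‖f x‖ₑ ≤ 2 ^ (k + 1) * volume (univ : Set Torus) := by
        have ht : Tendsto (fun k : ℕ => (k : ℝ≥0∞)) atTop (𝓝 ∞) := ENNReal.tendsto_nat_nhds_top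
        filter_upwards [ht.eventually (lt_mem_nhds hfi.lt_top)] with k hk
        calc ∫⁻ x, ‖f x‖ₑ ≤ k := hk.le
          _ ≤ 2 ^ (k + 1) := by
              exact_mod_cast (Nat.lt_two_pow_self.trans (Nat.pow_lt_pow_succ one_lt_two)).le
          _ = 2 ^ (k + 1) * 1 := (mul_one _).symm
          _ ≤ 2 ^ (k + 1) * volume (univ : Set Torus) := by
              gcongr
              rw [volume_torus_univ]
              exact ENNReal.one_le_ofReal.2 (by linarith [Real.pi_gt_three])
      filter_upwards [hw', hbig] with k hk hb
      have := lintegral_le_mul_volume_maximalFunction f hf (h2 (k + 1)) hb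
      rw [pow_succ (2 : ℝ≥0∞) k, ENNReal.mul_div_cancel_right two_ne_zero ENNReal.ofNat_ne_top]
        at this
      rw [pow_succ (2 : ℝ≥0∞) k]
      calc ENNReal.ofReal (w (k + 1)) * ∫⁻ x in {x | 2 ^ k * 2 < ‖f x‖ₑ}, ‖f x‖ₑ
          ≤ (4 * ENNReal.ofReal (w k)) *
            (5 * (2 ^ k * 2) * volume {x | 2 ^ k < maximalFunction f x}) := mul_le_mul' hk this
        _ = _ := by ring
  · refine ENNReal.tsum_ne_top_of_eventually_succ_le (C := 40) (fun k => ?_)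
      ENNReal.ofNat_ne_top ?_
    · exact ENNReal.mul_ne_top (ENNReal.mul_ne_top ENNReal.ofReal_ne_top (h2 k))
        (measure_ne_top _ _)
    · filter_upwards [hw'] with k hk
      have := mul_volume_maximalFunction_le f hf (h2 k)
      rw [pow_succ (2 : ℝ≥0∞) k, mul_comm (2 ^ k) 2]
      calc ENNReal.ofReal (w (k + 1)) * (2 * 2 ^ k) *
            volume {x | 2 * 2 ^ k < maximalFunction f x}
          = ENNReal.ofReal (w (k + 1)) * 2 *
            (2 ^ k * volume {x | 2 * 2 ^ k < maximalFunction f x}) := by ring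
        _ ≤ (4 * ENNReal.ofReal (w k)) * 2 * (5 * ∫⁻ x in {x | 2 ^ k < ‖f x‖ₑ}, ‖f x‖ₑ) := by
            gcongr
        _ = _ := by ring

lemma lintegral_ne_top_of_le_mul_one_add {φ a b : Torus → ℝ≥0∞} (hφm : AEMeasurable φ volume)
    (hφ : ∫⁻ x, φ x ≠ ∞) {K : ℝ≥0∞} (hK : K ≠ ∞) (h : ∀ᵐ x, a x ≤ K * (φ x + b x))
    (hb : ∫⁻ x, b x ≠ ∞) : ∫⁻ x, a x ≠ ∞ := by
  refine ne_top_of_le_ne_top ?_ (lintegral_mono_ae h)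
  rw [lintegral_const_mul' _ _ hK, lintegral_add_left' hφm]
  exact ENNReal.mul_ne_top hK (ENNReal.add_ne_top.2 ⟨hφ, hb⟩)

/-- Transfer of an Orlicz condition between `M f` and `f`, for functions comparable to dyadic
sums. -/
lemma lintegral_orliczEval_maximalFunction_ne_top_iff (f : Torus → ℂ)
    (hf : AEStronglyMeasurable f volume) (hfi : ∫⁻ x, ‖f x‖ₑ ≠ ∞) {w : ℕ → ℝ}
    (hw : ∀ᶠ k in atTop, w (k + 1) ≤ 4 * w k) {Φ ψ : ℝ → ℝ}
    (hΦ : ∃ K : ℝ≥0∞, K ≠ ∞ ∧ ∀ t : ℝ, 0 ≤ t →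
      ENNReal.ofReal (Φ t) ≤ K * (1 + dyadicSum (fun k => w k * 2 ^ k) (ENNReal.ofReal t)) ∧
      dyadicSum (fun k => w k * 2 ^ k) (ENNReal.ofReal t) ≤ K * (1 + ENNReal.ofReal (Φ t)))
    (hψ : ∃ K : ℝ≥0∞, K ≠ ∞ ∧ ∀ t : ℝ, 0 ≤ t →
      ENNReal.ofReal (ψ t) ≤ K * (1 + dyadicSum w (ENNReal.ofReal t)) ∧
      dyadicSum w (ENNReal.ofReal t) ≤ K * (1 + ENNReal.ofReal (ψ t))) :
    ∫⁻ x, orliczEval Φ (maximalFunction f x) ≠ ∞ ↔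
      ∫⁻ x, orliczEval (fun t => t * ψ t) ‖f x‖ₑ ≠ ∞ := by
  obtain ⟨K, hK, hKΦ⟩ := hΦ
  obtain ⟨L, hL, hLψ⟩ := hψ
  have hae := ae_maximalFunction_ne_top f hf hfi
  have h1 : ∫⁻ _ : Torus, 1 ≠ ∞ := by
    rw [lintegral_one]; exact measure_ne_top _ _
  have hev : ∀ x, orliczEval (fun t => t * ψ t) ‖f x‖ₑ = ‖f x‖ₑ * ENNReal.ofReal (ψ ‖f x‖) := by
    intro x
    rw [orliczEval, if_neg enorm_ne_top, toReal_enorm, ENNReal.ofReal_mul (norm_nonneg _),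
      ofReal_norm]
  have hL' : ∀ x, ENNReal.ofReal (ψ ‖f x‖) ≤ L * (1 + dyadicSum w ‖f x‖ₑ) ∧
      dyadicSum w ‖f x‖ₑ ≤ L * (1 + ENNReal.ofReal (ψ ‖f x‖)) := fun x => by
    simpa only [ofReal_norm] using hLψ ‖f x‖ (norm_nonneg _)
  have hK' : ∀ᵐ x, orliczEval Φ (maximalFunction f x) ≤
        K * (1 + dyadicSum (fun k => w k * 2 ^ k) (maximalFunction f x)) ∧
      dyadicSum (fun k => w k * 2 ^ k) (maximalFunction f x) ≤
        K * (1 + orliczEval Φ (maximalFunction f x)) := by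
    filter_upwards [hae] with x hx
    rw [orliczEval, if_neg hx]
    simpa only [ENNReal.ofReal_toReal hx] using hKΦ (maximalFunction f x).toReal ENNReal.toReal_nonneg
  have eM : ∫⁻ x, orliczEval Φ (maximalFunction f x) ≠ ∞ ↔
      ∫⁻ x, dyadicSum (fun k => w k * 2 ^ k) (maximalFunction f x) ≠ ∞ :=
    ⟨lintegral_ne_top_of_le_mul_one_add aemeasurable_const h1 hK (hK'.mono fun x hx => hx.2),
      lintegral_ne_top_of_le_mul_one_add aemeasurable_const h1 hK (hK'.mono fun x hx => hx.1)⟩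
  rw [eM, lintegral_dyadicSum_maximalFunction_ne_top_iff f hf hfi hw]
  simp_rw [hev]
  -- Multiplied by `|f|`, the additive `1` becomes `|f|`, which is integrable.
  refine ⟨lintegral_ne_top_of_le_mul_one_add hf.enorm hfi hL (Eventually.of_forall fun x => ?_),
    lintegral_ne_top_of_le_mul_one_add hf.enorm hfi hL (Eventually.of_forall fun x => ?_)⟩
  · calc ‖f x‖ₑ * ENNReal.ofReal (ψ ‖f x‖) ≤ ‖f x‖ₑ * (L * (1 + dyadicSum w ‖f x‖ₑ)) := by
          gcongr; exact (hL' x).1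
      _ = _ := by ring
  · calc ‖f x‖ₑ * dyadicSum w ‖f x‖ₑ ≤ ‖f x‖ₑ * (L * (1 + ENNReal.ofReal (ψ ‖f x‖))) := by
          gcongr; exact (hL' x).2
      _ = _ := by ring

lemma exists_dyadicSum_comparison_mul {u : ℕ → ℝ} (hu : ∀ k, 0 ≤ u k) {h : ℝ → ℝ}
    (hmono : MonotoneOn h (Ici 0)) (h0 : ∀ x, 0 ≤ h x) (hcont : Continuous h)
    (hsq : ∀ᶠ x : ℝ in atTop, h (x ^ 2) ≤ 2 * h x)
    (hU : ∀ᶠ n : ℕ in atTop, ∑ k ∈ Finset.range (n.sqrt + 1), u k ≤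
      3 / 4 * ∑ k ∈ Finset.range (n + 1), u k)
    {β : ℝ → ℝ} (hβc : ContinuousOn β (Ici 0)) {C : ℝ} (hC : 0 ≤ C)
    (hβ : ∀ᶠ n : ℕ in atTop, ∀ t ∈ Ioc ((2 : ℝ) ^ n) (2 ^ (n + 1)),
      β t ≤ C * ∑ k ∈ Finset.range (n + 1), u k ∧
      ∑ k ∈ Finset.range (n + 1), u k ≤ C * β t) :
    ∃ K : ℝ≥0∞, K ≠ ∞ ∧ ∀ t : ℝ, 0 ≤ t →
      ENNReal.ofReal (β t * h (Real.posLog t)) ≤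
        K * (1 + dyadicSum (fun k => u k * h k) (ENNReal.ofReal t)) ∧
      dyadicSum (fun k => u k * h k) (ENNReal.ofReal t) ≤
        K * (1 + ENNReal.ofReal (β t * h (Real.posLog t))) := by
  refine exists_dyadicSum_comparison (fun k => mul_nonneg (hu k) (h0 _)) (fun R => ?_)
    (by positivity : 0 ≤ 32 * C) (eventually_sum_mul_comparison hu hmono h0 hsq hU hC hβ)
  have hc : ContinuousOn (fun t => β t * h (Real.posLog t)) (Icc 0 R) :=
    (hβc.mono Icc_subset_Ici_self).mul (hcont.comp Real.continuous_posLog).continuousOn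
  obtain ⟨K, hK⟩ := isCompact_Icc.bddAbove_image hc
  exact ⟨K, fun t ht => hK ⟨t, ht, rfl⟩⟩

/-! ### The concrete weights -/

lemma comparison_mul_posLog : ∀ᶠ n : ℕ in atTop, ∀ t ∈ Ioc ((2 : ℝ) ^ n) (2 ^ (n + 1)),
    t * Real.posLog t ≤ 8 * ∑ k ∈ Finset.range (n + 1), (k : ℝ) * 2 ^ k ∧
    ∑ k ∈ Finset.range (n + 1), (k : ℝ) * 2 ^ k ≤ 8 * (t * Real.posLog t) := by
  filter_upwards [eventually_ge_atTop 1] with n hn t ht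
  obtain ⟨h1, h2, -⟩ := nat_mul_half_le_posLog ht
  have hn1 : (1 : ℝ) ≤ n := by exact_mod_cast hn
  have hle := sum_mul_two_pow_le n
  have hge : (n : ℝ) * 2 ^ n ≤ ∑ k ∈ Finset.range (n + 1), (k : ℝ) * 2 ^ k :=
    Finset.single_le_sum (f := fun k : ℕ => (k : ℝ) * 2 ^ k) (fun k _ => by positivity)
      (Finset.self_mem_range_succ n)
  have hp : (0 : ℝ) < 2 ^ n := by positivity
  obtain ⟨ht1, ht2⟩ := ht
  rw [pow_succ] at ht2
  constructor
  · have : t * Real.posLog t ≤ (2 ^ n * 2) * (n + 1) :=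
      mul_le_mul ht2 h2 Real.posLog_nonneg (by positivity)
    nlinarith
  · have : 2 ^ n * ((n : ℝ) / 2) ≤ t * Real.posLog t :=
      mul_le_mul ht1.le h1 (by positivity) (by linarith)
    nlinarith

lemma sum_range_succ_cast (n : ℕ) :
    ∑ k ∈ Finset.range (n + 1), (k : ℝ) = n * (n + 1) / 2 := by
  induction n with
  | zero => simp
  | succ n ih => rw [Finset.sum_range_succ, ih]; push_cast; ring

lemma comparison_posLog_sq : ∀ᶠ n : ℕ in atTop, ∀ t ∈ Ioc ((2 : ℝ) ^ n) (2 ^ (n + 1)),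
    Real.posLog t ^ 2 ≤ 8 * ∑ k ∈ Finset.range (n + 1), (k : ℝ) ∧
    ∑ k ∈ Finset.range (n + 1), (k : ℝ) ≤ 8 * Real.posLog t ^ 2 := by
  filter_upwards [eventually_ge_atTop 1] with n hn t ht
  obtain ⟨h1, h2, -⟩ := nat_mul_half_le_posLog ht
  have hn1 : (1 : ℝ) ≤ n := by exact_mod_cast hn
  rw [sum_range_succ_cast]
  constructor <;> nlinarith

lemma sum_sqrt_cast_le : ∀ᶠ n : ℕ in atTop, ∑ k ∈ Finset.range (n.sqrt + 1), (k : ℝ) ≤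
    3 / 4 * ∑ k ∈ Finset.range (n + 1), (k : ℝ) := by
  filter_upwards [eventually_ge_atTop 2] with n hn
  have hn2 : (2 : ℝ) ≤ n := by exact_mod_cast hn
  have h1 : ((n.sqrt : ℕ) : ℝ) ^ 2 ≤ n := by exact_mod_cast Nat.sqrt_le' n
  have h2 : ((n.sqrt : ℕ) : ℝ) ≤ n := by exact_mod_cast Nat.sqrt_le_self n
  rw [sum_range_succ_cast, sum_range_succ_cast]
  nlinarith

lemma comparison_div_log : ∀ᶠ n : ℕ in atTop, ∀ t ∈ Ioc ((2 : ℝ) ^ n) (2 ^ (n + 1)),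
    t / Real.log (Real.exp 1 + t) ≤
      8 * ∑ k ∈ Finset.range (n + 1), 1 / ((k : ℝ) + 1) * 2 ^ k ∧
    ∑ k ∈ Finset.range (n + 1), 1 / ((k : ℝ) + 1) * 2 ^ k ≤
      8 * (t / Real.log (Real.exp 1 + t)) := by
  filter_upwards [eventually_ge_atTop 2] with n hn t ht
  obtain ⟨h1, h2, h3⟩ := nat_mul_half_le_posLog ht
  rw [h3] at h1 h2
  have hn2 : (2 : ℝ) ≤ n := by exact_mod_cast hn
  have hle := sum_one_div_mul_two_pow_le n
  have hge : 1 / ((n : ℝ) + 1) * 2 ^ n ≤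
      ∑ k ∈ Finset.range (n + 1), 1 / ((k : ℝ) + 1) * 2 ^ k :=
    Finset.single_le_sum (f := fun k : ℕ => 1 / ((k : ℝ) + 1) * 2 ^ k)
      (fun k _ => by positivity) (Finset.self_mem_range_succ n)
  have hp : (4 : ℝ) ≤ 2 ^ n := by
    calc (4 : ℝ) = 2 ^ 2 := by norm_num
      _ ≤ 2 ^ n := pow_le_pow_right₀ one_le_two hn
  obtain ⟨ht1, ht2⟩ := ht
  rw [pow_succ] at ht2
  have ht4 : 4 < t := hp.trans_lt ht1
  have he := Real.exp_one_lt_d9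
  have hlog1 : Real.log t ≤ Real.log (Real.exp 1 + t) :=
    Real.log_le_log (by linarith) (by linarith [Real.exp_pos 1])
  have hlog2 : Real.log (Real.exp 1 + t) ≤ 2 * Real.log t := by
    rw [← Nat.cast_two, ← Real.log_pow]
    exact Real.log_le_log (by positivity) (by nlinarith)
  have hpos : 0 < Real.log (Real.exp 1 + t) := by linarith
  constructor
  · refine le_trans ?_ (mul_le_mul_of_nonneg_left hge (by norm_num))
    rw [one_div_mul_eq_div, ← mul_div_assoc, div_le_div_iff₀ hpos (by positivity)]
    calc t * (n + 1) ≤ (2 ^ n * 2) * (4 * (n / 2)) := by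
          gcongr
          linarith
      _ = 8 * 2 ^ n * (n / 2) := by ring
      _ ≤ 8 * 2 ^ n * Real.log (Real.exp 1 + t) := by gcongr; linarith
  · refine hle.trans ?_
    rw [one_div_mul_eq_div, ← mul_div_assoc, ← mul_div_assoc,
      div_le_div_iff₀ (by positivity) hpos]
    calc 4 * 2 ^ n * Real.log (Real.exp 1 + t) ≤ 4 * t * (2 * (n + 1)) := by
          gcongr
          linarith
      _ = 8 * t * (n + 1) := by ring

lemma log_add_two_le_sum_one_div (n : ℕ) :
    Real.log (n + 2) ≤ ∑ k ∈ Finset.range (n + 1), 1 / ((k : ℝ) + 1) ∧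
    ∑ k ∈ Finset.range (n + 1), 1 / ((k : ℝ) + 1) ≤ 1 + Real.log (n + 1) := by
  have h1 := log_add_one_le_harmonic (n + 1)
  have h2 := harmonic_le_one_add_log (n + 1)
  rw [← harmonic_real] at h1 h2
  push_cast at h1 h2
  rw [show (n : ℝ) + 1 + 1 = n + 2 by ring] at h1
  exact ⟨h1, h2⟩

lemma comparison_posLog_posLog : ∀ᶠ n : ℕ in atTop, ∀ t ∈ Ioc ((2 : ℝ) ^ n) (2 ^ (n + 1)),
    Real.posLog (Real.posLog t) ≤ 8 * ∑ k ∈ Finset.range (n + 1), 1 / ((k : ℝ) + 1) ∧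
    ∑ k ∈ Finset.range (n + 1), 1 / ((k : ℝ) + 1) ≤ 8 * Real.posLog (Real.posLog t) := by
  filter_upwards [eventually_ge_atTop 8] with n hn t ht
  obtain ⟨h1, h2, -⟩ := nat_mul_half_le_posLog ht
  have hn8 : (8 : ℝ) ≤ n := by exact_mod_cast hn
  obtain ⟨hU1, hU2⟩ := log_add_two_le_sum_one_div n
  set l := Real.posLog t
  have hl : 4 ≤ l := by linarith
  rw [Real.posLog_eq_log (by rw [abs_of_pos (by linarith)]; linarith)]
  have e1 : Real.log l ≤ Real.log (n + 2) := Real.log_le_log (by linarith) (by linarith)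
  have e2 : Real.log (n + 1) ≤ 2 * Real.log l := by
    rw [← Nat.cast_two, ← Real.log_pow]
    exact Real.log_le_log (by positivity) (by nlinarith)
  have e3 : 1 ≤ Real.log l := by
    rw [Real.le_log_iff_exp_le (by linarith)]
    linarith [Real.exp_one_lt_d9]
  constructor <;> linarith

lemma sum_sqrt_one_div_le :
    ∀ᶠ n : ℕ in atTop, ∑ k ∈ Finset.range (n.sqrt + 1), 1 / ((k : ℝ) + 1) ≤
      3 / 4 * ∑ k ∈ Finset.range (n + 1), 1 / ((k : ℝ) + 1) := by
  filter_upwards [(Real.tendsto_log_atTop.comp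
    tendsto_natCast_atTop_atTop).eventually_ge_atTop 8, eventually_ge_atTop 1] with n hn hn1
  have hU1 := (log_add_two_le_sum_one_div n).1
  have hU2 := (log_add_two_le_sum_one_div n.sqrt).2
  have hn1R : (1 : ℝ) ≤ n := by exact_mod_cast hn1
  have h1 : ((n.sqrt : ℕ) : ℝ) ^ 2 ≤ n := by exact_mod_cast Nat.sqrt_le' n
  -- With `s = √n` this is `(s + 1) ^ 2 ≤ 2 * s ^ 2 + 2 ≤ 2 * (n + 2)`. So the sum up to `√n` is
  -- about half the full one, and `log n ≥ 8` lets the factor `3 / 4` absorb the constants.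
  have e1 : 2 * Real.log (n.sqrt + 1) ≤ Real.log 2 + Real.log (n + 2) := by
    rw [← Real.log_mul two_ne_zero (by positivity), ← Nat.cast_two, ← Real.log_pow]
    refine Real.log_le_log (by positivity) ?_
    push_cast
    nlinarith [sq_nonneg ((n.sqrt : ℝ) - 1)]
  have e2 : Real.log n ≤ Real.log (n + 2) := Real.log_le_log (by linarith) (by linarith)
  simp only [Function.comp] at hn
  linarith [Real.log_two_lt_d9]

lemma succ_le_four_mul {u : ℕ → ℝ} (hu : ∀ k, 0 ≤ u k) (hu2 : ∀ᶠ k in atTop, u (k + 1) ≤ 2 * u k)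
    {h : ℝ → ℝ} (hmono : MonotoneOn h (Ici 0)) (h0 : ∀ x, 0 ≤ h x)
    (hsq : ∀ᶠ x : ℝ in atTop, h (x ^ 2) ≤ 2 * h x) :
    ∀ᶠ k : ℕ in atTop, u (k + 1) * h ((k + 1 : ℕ) : ℝ) ≤ 4 * (u k * h k) := by
  filter_upwards [hu2, tendsto_natCast_atTop_atTop.eventually hsq, eventually_ge_atTop 2]
    with k h1 h2 h3
  have hk : (2 : ℝ) ≤ k := by exact_mod_cast h3
  have h4 : h ((k + 1 : ℕ) : ℝ) ≤ 2 * h k := by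
    refine (hmono (mem_Ici.2 (Nat.cast_nonneg _)) (mem_Ici.2 (sq_nonneg (k : ℝ))) ?_).trans h2
    push_cast
    nlinarith
  calc u (k + 1) * h ((k + 1 : ℕ) : ℝ) ≤ (2 * u k) * (2 * h k) :=
        mul_le_mul h1 h4 (h0 _) (mul_nonneg zero_le_two (hu k))
    _ = 4 * (u k * h k) := by ring

/-! ### The two equivalences for integrable functions, and integrability -/

lemma lintegral_orliczEval_maximalFunction_ne_top_iff_mul_posLog (f : Torus → ℂ)
    (hf : AEStronglyMeasurable f volume) (hfi : ∫⁻ x, ‖f x‖ₑ ≠ ∞) :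
    ∫⁻ x, orliczEval (fun t => t * Real.posLog t * Real.posLog (Real.posLog t))
        (maximalFunction f x) ≠ ∞ ↔
      ∫⁻ x, orliczEval (fun t => t * (Real.posLog t ^ 2 * Real.posLog (Real.posLog t)))
        ‖f x‖ₑ ≠ ∞ := by
  have hsq : ∀ᶠ x : ℝ in atTop, Real.posLog (x ^ 2) ≤ 2 * Real.posLog x :=
    Eventually.of_forall fun x => (posLog_sq x).le
  have h0 : ∀ x : ℝ, 0 ≤ Real.posLog x := fun _ => Real.posLog_nonneg
  refine lintegral_orliczEval_maximalFunction_ne_top_iff f hf hfi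
    (w := fun k => (k : ℝ) * Real.posLog k) ?_ ?_ ?_
  · refine succ_le_four_mul (u := fun k => (k : ℝ)) (fun k => k.cast_nonneg) ?_
      Real.monotoneOn_posLog h0 hsq
    filter_upwards [eventually_ge_atTop 1] with k hk
    have : (1 : ℝ) ≤ k := by exact_mod_cast hk
    push_cast
    linarith
  · have hu : ∀ k : ℕ, 0 ≤ (k : ℝ) * 2 ^ k := fun k => by positivity
    -- The factor `2 ^ k` joins `k`, leaving the slowly varying factor `log⁺ k` to be pulled out.
    simp only [mul_right_comm _ (Real.posLog _) ((2 : ℝ) ^ _)]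
    refine exists_dyadicSum_comparison_mul hu Real.monotoneOn_posLog h0 Real.continuous_posLog hsq
      (sum_sqrt_le_of_le hu (Eventually.of_forall fun n => (sum_mul_two_pow_le n).trans ?_))
      (by fun_prop) (by norm_num) comparison_mul_posLog
    linarith [hu n]
  · exact exists_dyadicSum_comparison_mul (fun k => k.cast_nonneg) Real.monotoneOn_posLog h0
      Real.continuous_posLog hsq sum_sqrt_cast_le (by fun_prop) (by norm_num) comparison_posLog_sq

lemma lintegral_orliczEval_maximalFunction_ne_top_iff_div_log (f : Torus → ℂ)
    (hf : AEStronglyMeasurable f volume) (hfi : ∫⁻ x, ‖f x‖ₑ ≠ ∞) :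
    ∫⁻ x, orliczEval (fun t => t / Real.log (Real.exp 1 + t) * posLogThree (Real.posLog t))
        (maximalFunction f x) ≠ ∞ ↔
      ∫⁻ x, orliczEval (fun t => t * (Real.posLog (Real.posLog t) * posLogThree (Real.posLog t)))
        ‖f x‖ₑ ≠ ∞ := by
  refine lintegral_orliczEval_maximalFunction_ne_top_iff f hf hfi
    (w := fun k => 1 / ((k : ℝ) + 1) * posLogThree k) ?_ ?_ ?_
  · refine succ_le_four_mul (u := fun k => 1 / ((k : ℝ) + 1)) (fun k => by positivity)
      (Eventually.of_forall fun k => ?_) monotoneOn_posLogThree posLogThree_nonneg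
      eventually_posLogThree_sq_le
    have : 1 / (((k + 1 : ℕ) : ℝ) + 1) ≤ 1 / ((k : ℝ) + 1) := by
      push_cast
      gcongr
      linarith
    have : (0 : ℝ) ≤ 1 / ((k : ℝ) + 1) := by positivity
    linarith
  · have hu : ∀ k : ℕ, 0 ≤ 1 / ((k : ℝ) + 1) * 2 ^ k := fun k => by positivity
    simp only [mul_right_comm _ (posLogThree _) ((2 : ℝ) ^ _)]
    refine exists_dyadicSum_comparison_mul hu monotoneOn_posLogThree posLogThree_nonneg
      continuous_posLogThree eventually_posLogThree_sq_le
      (sum_sqrt_le_of_le hu (Eventually.of_forall sum_one_div_mul_two_pow_le))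
      (continuousOn_id.div (ContinuousOn.log (by fun_prop) fun t ht => ?_) fun t ht => ?_)
      (by norm_num) comparison_div_log
    · have := mem_Ici.1 ht
      positivity
    · have := mem_Ici.1 ht
      exact (Real.log_pos (by linarith [Real.exp_one_gt_d9])).ne'
  · exact exists_dyadicSum_comparison_mul (fun k => by positivity) monotoneOn_posLogThree
      posLogThree_nonneg continuous_posLogThree eventually_posLogThree_sq_le sum_sqrt_one_div_le
      (by fun_prop) (by norm_num) comparison_posLog_posLog

/-- For large `t` both logarithmic factors are at least `1`. On a space of finite measure this gives
the integrability of `Mf` demanded in part 1. -/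
lemma exists_le_add_orliczEval : ∃ T : ℝ≥0∞, T ≠ ∞ ∧ ∀ t : ℝ≥0∞,
    t ≤ T + orliczEval (fun t => t * Real.posLog t * Real.posLog (Real.posLog t)) t := by
  obtain ⟨T, hT⟩ := eventually_atTop.1 ((tendsto_posLog_atTop.eventually_ge_atTop 1).and
    ((tendsto_posLog_atTop.comp tendsto_posLog_atTop).eventually_ge_atTop 1))
  refine ⟨ENNReal.ofReal T, ENNReal.ofReal_ne_top, fun t => ?_⟩
  rcases eq_or_ne t ∞ with rfl | ht
  · simp [orliczEval]
  rw [orliczEval, if_neg ht]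
  rcases le_total t.toReal T with h | h
  · exact le_add_right ((ENNReal.le_ofReal_iff_toReal_le ht
      (ENNReal.toReal_nonneg.trans h)).2 h)
  · refine le_add_left ?_
    obtain ⟨h1, h2⟩ := hT _ h
    rw [← ENNReal.ofReal_toReal ht]
    refine ENNReal.ofReal_le_ofReal ?_
    rw [ENNReal.toReal_ofReal ENNReal.toReal_nonneg]
    have h0 : 0 ≤ t.toReal := ENNReal.toReal_nonneg
    calc t.toReal = t.toReal * 1 * 1 := by ring
      _ ≤ _ := mul_le_mul (mul_le_mul_of_nonneg_left h1 h0) h2 zero_le_one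
        (mul_nonneg h0 (zero_le_one.trans h1))

lemma lintegral_orliczEval_maximalFunction_eq_top {f : Torus → ℂ} (h : ∫⁻ x, ‖f x‖ₑ = ∞)
    (Φ : ℝ → ℝ) : ∫⁻ x, orliczEval Φ (maximalFunction f x) = ∞ := by
  simp only [maximalFunction_eq_top h, orliczEval, if_pos, lintegral_const]
  exact ENNReal.top_mul (by rw [volume_torus_univ]; simp [Real.pi_pos])

end

open Real in
theorem mainTheorem7 (f : Torus → ℂ) (hf : AEStronglyMeasurable f volume) :
    (MemOrliczClass (fun t => t * log⁺ t * log⁺ (log⁺ t)) (maximalFunction f) ↔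
      MemOrliczClass (fun t => t * (log⁺ t) ^ 2 * log⁺ (log⁺ t)) (fun x => ‖f x‖ₑ)) ∧
    (∫⁻ x, orliczEval
        (fun t => t / log (exp 1 + t) * log⁺ (log⁺ (log⁺ (log⁺ t)))) (maximalFunction f x) < ∞ ↔
      MemOrliczClass (fun t => t * log⁺ (log⁺ t) * log⁺ (log⁺ (log⁺ (log⁺ t))))
        (fun x => ‖f x‖ₑ)) := by
  -- Regroups the conditions on `f` into the form `t * ψ t`.
  simp only [mul_assoc _ (log⁺ _ ^ 2), mul_assoc _ (log⁺ (log⁺ _)) (log⁺ (log⁺ (log⁺ (log⁺ _))))]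
  refine ⟨⟨fun h => ?_, fun h => ?_⟩, ⟨fun h => ?_, fun h => ?_⟩⟩
  · have hfi : ∫⁻ x, ‖f x‖ₑ ≠ ∞ := fun htop =>
      h.lintegral_orlicz_lt_top.ne (lintegral_orliczEval_maximalFunction_eq_top htop _)
    exact ⟨hf.enorm, hfi.lt_top,
      ((lintegral_orliczEval_maximalFunction_ne_top_iff_mul_posLog f hf hfi).1
        h.lintegral_orlicz_lt_top.ne).lt_top⟩
  · have hM := (lintegral_orliczEval_maximalFunction_ne_top_iff_mul_posLog f hf
      h.lintegral_lt_top.ne).2 h.lintegral_orlicz_lt_top.ne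
    refine ⟨(measurable_maximalFunction f).aemeasurable, ?_, hM.lt_top⟩
    obtain ⟨T, hT, hle⟩ := exists_le_add_orliczEval
    refine (lintegral_mono fun x => hle (maximalFunction f x)).trans_lt ?_
    rw [lintegral_add_left measurable_const, lintegral_const]
    exact ENNReal.add_lt_top.2 ⟨ENNReal.mul_lt_top hT.lt_top (measure_lt_top _ _), hM.lt_top⟩
  · have hfi : ∫⁻ x, ‖f x‖ₑ ≠ ∞ := fun htop =>
      h.ne (lintegral_orliczEval_maximalFunction_eq_top htop _)
    exact ⟨hf.enorm, hfi.lt_top,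
      ((lintegral_orliczEval_maximalFunction_ne_top_iff_div_log f hf hfi).1 h.ne).lt_top⟩
  · exact ((lintegral_orliczEval_maximalFunction_ne_top_iff_div_log f hf
      h.lintegral_lt_top.ne).2 h.lintegral_orlicz_lt_top.ne).lt_top
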